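/- Let $\mathbb K$ be a field, $V$ a finite-dimensional $\mathbb K$-vector space of dimension $\ell$, and $\mathcal A$ a finite set of linear hyperplanes of $V$ (a central arrangement, possibly empty). Let $L(\mathcal A)$ be the set of all intersections of subsets of $\mathcal A$, the empty intersection being $V$. For $X\in L(\mathcal A)$ let $\mathcal A^X=\{X\cap H \mid H\in\mathcal A,\ X\not\subseteq H\}$, an arrangement in $X$. For $H_0\in\mathcal A$ put $\mathcal A'=\mathcal A\setminus\{H_0\}$ and $\mathcal A''=\mathcal A^{H_0}$. Let $S=S(V^*)$ be the symmetric algebra of $V^*$, and for $H\in\mathcal A$ let $\alpha_H\in V^*$ have kernel $H$. Let $D(\mathcal A)=\{\theta\in\mathrm{Der}_{\mathbb K}(S)\mid \theta(\alpha_H)\in\alpha_H S \text{ for all } H\in\mathcal A\}$. The arrangement $\mathcal A$ is free with exponents $\exp\mathcal A=\{b_1,\dots,b_\ell\}$ (a multiset) if the $S$-module $D(\mathcal A)$ has a basis $\theta_1,\dots,\theta_\ell$ such that $\theta_i(V^*)\subseteq S_{b_i}$ for every $i$, where $S_b$ is the homogeneous component of $S$ of degree $b$. The class of inductively free arrangements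 is the smallest class of central arrangements in finite-dimensional $\mathbb K$-vector spaces such that * all empty arrangements belong to it; * if for some $H_0\in\mathcal A$ both $\mathcal A'$ and $\mathcal A''$ belong to it and are free with $\exp\mathcal A''\subseteq\exp\mathcal A'$ (as multisets), then $\mathcal A$ belongs to it. The class of inductive factorizations is the smallest class of pairs $(\mathcal A,\pi)$, with $\mathcal A$ such an arrangement and $\pi$ a partition of $\mathcal A$ into non-empty blocks, such that * every empty arrangement together with its empty partition belongs to it; * $(\mathcal A,\pi)$ belongs to it if there are a block $\pi_1$ of $\pi$ and a hyperplane $H_0\in\pi_1$ such that the map $\varrho:\mathcal A\setminus\pi_1\to\mathcal A''$, $H\mapsto H\cap H_0$, is bijective, and $(\mathcal A',\pi')$ and $(\mathcal A'',\pi'')$ belong to it, where $\pi'$ is the partition of $\mathcal A'$ into the non-empty sets $P\cap\mathcal A'$ for $P\in\pi$, and $\pi''$ is the partition of $\mathcal A''$ into the sets $\varrho(P)$ for $P\in\pi$, $P\neq\pi_1$. The arrangement $\mathcal A$ is inductively factored if $(\mathcal A,\pi)$ belongs to this class for some $\pi$. The arrangement $\mathcal A$ is hereditarily inductively factored (respectively,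 hereditarily inductively free) if $\mathcal A^X$ is inductively factored (respectively, inductively free) for every $X\in L(\mathcal A)$. Then: if $\mathcal A$ is hereditarily inductively factored, then $\mathcal A$ is hereditarily inductively free. -/

import Mathlib

open Module

universe u v

/-- A central hyperplane arrangement in the `K`-vector space `V`: a finite set of linear
hyperplanes, i.e. of maximal proper subspaces of `V`. -/
structure HypArrangement (K : Type u) [Field K] (V : Type v) [AddCommGroup V] [Module K V] where
  /-- the hyperplanes of the arrangement -/
  hyps : Finset (Submodule K V)
  isCoatom : ∀ H ∈ hyps, IsCoatom H

/-- If `X` is not contained in the hyperplane `H`, then `X ∩ H` is a hyperplane in `X`. -/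
theorem isCoatom_comap_subtype {K : Type u} [Field K] {V : Type v} [AddCommGroup V] [Module K V]
    {X H : Submodule K V} (hH : IsCoatom H) (hX : ¬ X ≤ H) :
    IsCoatom (H.comap X.subtype) := by
  refine ⟨fun h => hX (Submodule.comap_subtype_eq_top.mp h), fun W hW => ?_⟩
  obtain ⟨hle, hnot⟩ := SetLike.lt_iff_le_and_exists.mp hW
  obtain ⟨w, hwW, hwH⟩ := hnot
  have hsup : H ⊔ Submodule.span K {(w : V)} = ⊤ := by
    refine hH.2 _ (lt_of_le_of_ne le_sup_left fun h => hwH ?_)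
    have : (w : V) ∈ H ⊔ Submodule.span K {(w : V)} :=
      Submodule.mem_sup_right (Submodule.mem_span_singleton_self _)
    rw [← h] at this
    exact this
  refine eq_top_iff.mpr fun x _ => ?_
  have hx : (x : V) ∈ H ⊔ Submodule.span K {(w : V)} := by rw [hsup]; trivial
  obtain ⟨y, hy, z, hz, hyz⟩ := Submodule.mem_sup.mp hx
  obtain ⟨c, rfl⟩ := Submodule.mem_span_singleton.mp hz
  have h1 : x - c • w ∈ H.comap X.subtype := by
    have : ((x - c • w : X) : V) = y := by
      rw [Submodule.coe_sub, Submodule.coe_smul, ← hyz]; abel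
    simpa [Submodule.mem_comap, this] using hy
  have h2 : x = (x - c • w) + c • w := by abel
  rw [h2]
  exact W.add_mem (hle h1) (W.smul_mem c hwW)

namespace HypArrangement

section

variable {K : Type u} [Field K] {V : Type v} [AddCommGroup V] [Module K V]

/-- The empty arrangement in `V`. -/
def empty (K : Type u) [Field K] (V : Type v) [AddCommGroup V] [Module K V] :
    HypArrangement K V where
  hyps := ∅
  isCoatom := by simp

/-- The intersection lattice `L(A)`: all intersections of subsets of `A`; the intersection of
the empty subset is `V`. -/
def lattice (A : HypArrangement K V) : Set (Submodule K V) :=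
  {X | ∃ B : Finset (Submodule K V), B ⊆ A.hyps ∧ X = B.inf id}

open scoped Classical in
/-- The deletion `A' = A \ {H₀}`. -/
noncomputable def deletion (A : HypArrangement K V) (H₀ : Submodule K V) :
    HypArrangement K V where
  hyps := A.hyps.erase H₀
  isCoatom := fun H hH => A.isCoatom H (Finset.mem_of_mem_erase hH)

open scoped Classical in
/-- The restriction `A^X = {X ∩ H | H ∈ A, X ⊄ H}`, an arrangement in the vector space `X`;
the subspace `X ∩ H` of `X` is `H.comap X.subtype`. -/
noncomputable def restriction (A : HypArrangement K V) (X : Submodule K V) :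
    HypArrangement K X where
  hyps := (A.hyps.filter fun H => ¬ X ≤ H).image fun H => H.comap X.subtype
  isCoatom := by
    intro Y hY
    obtain ⟨H, hH, rfl⟩ := Finset.mem_image.mp hY
    obtain ⟨hHA, hXH⟩ := Finset.mem_filter.mp hH
    exact isCoatom_comap_subtype (A.isCoatom H hHA) hXH

/-! ### Derivations and exponents -/

/-- The coordinate ring `S = S(V*)`, the symmetric algebra of the dual space of `V`. -/
def CoordRing (K : Type u) [Field K] (V : Type v) [AddCommGroup V] [Module K V] : Type (max u v) :=
  SymmetricAlgebra K (Dual K V)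

noncomputable instance : CommRing (CoordRing K V) :=
  inferInstanceAs (CommRing (SymmetricAlgebra K (Dual K V)))

noncomputable instance : Algebra K (CoordRing K V) :=
  inferInstanceAs (Algebra K (SymmetricAlgebra K (Dual K V)))

/-- The embedding `V* → S(V*)` of the linear forms. -/
noncomputable def linForm (K : Type u) [Field K] (V : Type v) [AddCommGroup V] [Module K V] :
    Dual K V →ₗ[K] CoordRing K V :=
  SymmetricAlgebra.ι K (Dual K V)

/-- The module of `A`-derivations: the `S`-submodule `D(A)` of `Der_K(S)` of all `θ` such that
`α_H` divides `θ(α_H)` for every `H ∈ A`, where `α_H ∈ V*` is a linear form with kernel `H`. -/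
noncomputable def derivationModule (A : HypArrangement K V) :
    Submodule (CoordRing K V) (Derivation K (CoordRing K V) (CoordRing K V)) where
  carrier := {θ | ∀ H ∈ A.hyps, ∀ α : Dual K V, LinearMap.ker α = H →
    linForm K V α ∣ θ (linForm K V α)}
  add_mem' := fun ha hb H hH α hα => by
    rw [Derivation.add_apply]
    exact dvd_add (ha H hH α hα) (hb H hH α hα)
  zero_mem' := fun H _ α _ => by simp
  smul_mem' := fun c θ hθ H hH α hα => by
    rw [Derivation.smul_apply, smul_eq_mul]
    exact Dvd.dvd.mul_left (hθ H hH α hα) c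

/-- The homogeneous component `S_d`, spanned by all products of `d` linear forms. -/
noncomputable def homogComponent (K : Type u) [Field K] (V : Type v) [AddCommGroup V] [Module K V] (d : ℕ) :
    Submodule K (CoordRing K V) :=
  LinearMap.range (linForm K V) ^ d

/-- `θ` is homogeneous of polynomial degree `d`: it maps linear forms into `S_d`. -/
def IsHomogDerivation (θ : Derivation K (CoordRing K V) (CoordRing K V)) (d : ℕ) : Prop :=
  ∀ α : Dual K V, θ (linForm K V α) ∈ homogComponent K V d

/-- `A` is free with multiset of exponents `m`: the `S`-module `D(A)` has a basis
`θ₁, …, θ_ℓ` (`ℓ = dim V`) of homogeneous derivations, and `m` is the multiset of their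
polynomial degrees. -/
def IsFreeWithExponents (A : HypArrangement K V) (m : Multiset ℕ) : Prop :=
  ∃ (b : Basis (Fin (finrank K V)) (CoordRing K V) A.derivationModule)
    (d : Fin (finrank K V) → ℕ),
    (∀ i, IsHomogDerivation (b i : Derivation K (CoordRing K V) (CoordRing K V)) (d i)) ∧
      m = Finset.univ.val.map d

end

/-! ### Inductively free and inductively factored arrangements -/

/-- The smallest class of arrangements over `K` that contains all empty arrangements, and
contains `A` as soon as, for some `H₀ ∈ A`, it contains `A' = A \ {H₀}` and `A'' = A^{H₀}` and
`exp A'' ⊆ exp A'` as multisets. -/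
inductive IsInductivelyFree {K : Type u} [Field K] :
    ∀ {V : Type v} [AddCommGroup V] [Module K V] [FiniteDimensional K V],
      HypArrangement K V → Prop
  | empty {V : Type v} [AddCommGroup V] [Module K V] [FiniteDimensional K V] :
      IsInductivelyFree (HypArrangement.empty K V)
  | add {V : Type v} [AddCommGroup V] [Module K V] [FiniteDimensional K V]
      (A : HypArrangement K V) (H₀ : Submodule K V) (mem : H₀ ∈ A.hyps)
      (del : IsInductivelyFree (A.deletion H₀))
      (res : IsInductivelyFree (A.restriction H₀))
      (e' e'' : Multiset ℕ)
      (exp_del : (A.deletion H₀).IsFreeWithExponents e')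
      (exp_res : (A.restriction H₀).IsFreeWithExponents e'')
      (exp_le : e'' ≤ e') :
      IsInductivelyFree A

open scoped Classical in
/-- The smallest class of pairs `(A, π)` of an arrangement `A` over `K` and a partition `π` of
`A` into non-empty blocks that contains the empty arrangements with their only partition, and
contains `(A, π)` as soon as, for some block `P₁` of `π` and some `H₀ ∈ P₁`,
* the restriction map `A \ P₁ → A''`, `H ↦ H ∩ H₀`, is bijective,
* `(A', π')` is in the class, where `π'` consists of the non-empty sets `P ∩ A'`, `P ∈ π`,
* `(A'', π'')` is in the class, where `π''` consists of the images of the blocks `P ≠ P₁`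
  of `π` under the restriction map. -/
inductive IsInductiveFactorization {K : Type u} [Field K] :
    ∀ {V : Type v} [AddCommGroup V] [Module K V] [FiniteDimensional K V]
      (A : HypArrangement K V), Finpartition A.hyps → Prop
  | empty {V : Type v} [AddCommGroup V] [Module K V] [FiniteDimensional K V]
      (π : Finpartition (HypArrangement.empty K V).hyps) :
      IsInductiveFactorization (HypArrangement.empty K V) π
  | add {V : Type v} [AddCommGroup V] [Module K V] [FiniteDimensional K V]
      (A : HypArrangement K V) (π : Finpartition A.hyps)
      (P₁ : Finset (Submodule K V)) (block : P₁ ∈ π.parts)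
      (H₀ : Submodule K V) (mem : H₀ ∈ P₁)
      (bij : Set.BijOn (fun H : Submodule K V => H.comap H₀.subtype)
        (↑(A.hyps \ P₁) : Set (Submodule K V))
        (↑(A.restriction H₀).hyps : Set (Submodule K H₀)))
      (π' : Finpartition (A.deletion H₀).hyps)
      (parts_del : π'.parts = (π.parts.image fun P => P ∩ (A.deletion H₀).hyps).erase ∅)
      (del : IsInductiveFactorization (A.deletion H₀) π')
      (π'' : Finpartition (A.restriction H₀).hyps)
      (parts_res : π''.parts =
        (π.parts.erase P₁).image fun P => P.image fun H => H.comap H₀.subtype)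
      (res : IsInductiveFactorization (A.restriction H₀) π'') :
      IsInductiveFactorization A π

section

variable {K : Type u} [Field K] {V : Type v} [AddCommGroup V] [Module K V]
  [FiniteDimensional K V]

open scoped Classical in
/-- `A` is inductively factored if it has an inductive factorization. -/
def IsInductivelyFactored (A : HypArrangement K V) : Prop :=
  ∃ π : Finpartition A.hyps, IsInductiveFactorization A π

/-- `A^X` is inductively factored for every `X ∈ L(A)`. -/
def IsHereditarilyInductivelyFactored (A : HypArrangement K V) : Prop :=
  ∀ X ∈ A.lattice, (A.restriction X).IsInductivelyFactored

/-- `A^X` is inductively free for every `X ∈ L(A)`. -/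
def IsHereditarilyInductivelyFree (A : HypArrangement K V) : Prop :=
  ∀ X ∈ A.lattice, (A.restriction X).IsInductivelyFree

end

end HypArrangement

/-! It suffices to show that an inductively factored arrangement is inductively free and then apply
this to every `A^X`. For the induction to close, the exponents are carried along: they are the
cardinalities of the blocks, padded with zeros up to the dimension
(`IsInductiveFactorization.isInductivelyFree`). Let `P₁` be the distinguished block, with `n + 1`
elements, and `m` the exponents of `A''`. As `ϱ` is bijective, `m` consists of the sizes of the
other blocks and zeros; the exponents of `A'` are `m` together with `n`. So `exp A'' ⊆ exp A'`, and
what remains is an addition theorem: `A` is free with exponents `m` together with `n + 1`.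

Let `α` define `H₀` and let `B` be the product of the restrictions to `H₀` of the forms of `P₁ \
{H₀}`, of degree `n`. The combinatorial input is `prod_resHom_dvd`: `B` divides `θ(α)|H₀` for all `θ
∈ D(A')`, because every element of `A''` is cut out by a hyperplane outside `P₁`.

The algebraic input is `isFreeWithExponents_of_deletion_of_restriction`. If `θ(α)|H₀` vanished for
all basis elements of `D(A')` of degree at most `n`, these would restrict to independent elements of
`D(A'')`, one more than the basis elements of `D(A'')` of such degrees can span. Hence some basis
element `θ_k` of degree `n` has `θ_k(α)|H₀ = c B` with `c` a nonzero constant. Subtracting multiples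
of `θ_k` from the other basis elements and replacing `θ_k` by `α θ_k` gives a basis of `D(A)`. -/

namespace HypArrangement

/-! ### The symmetric algebra of the dual space -/

section CoordRing

variable {K : Type u} [Field K] {V : Type v} [AddCommGroup V] [Module K V]

instance : IsDomain (CoordRing K V) :=
  inferInstanceAs (IsDomain (SymmetricAlgebra K (Dual K V)))

instance : UniqueFactorizationMonoid (CoordRing K V) :=
  (SymmetricAlgebra.equivMvPolynomial
    (Basis.ofVectorSpace K (Dual K V))).symm.toMulEquiv.uniqueFactorizationMonoid inferInstance

/-- The universal property of `S(V*)`. -/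
noncomputable def coordLift {B : Type*} [CommRing B] [Algebra K B] (f : Dual K V →ₗ[K] B) :
    CoordRing K V →ₐ[K] B :=
  SymmetricAlgebra.lift f

@[simp]
theorem coordLift_linForm {B : Type*} [CommRing B] [Algebra K B] (f : Dual K V →ₗ[K] B)
    (α : Dual K V) : coordLift f (linForm K V α) = f α :=
  SymmetricAlgebra.lift_ι_apply f α

theorem coordRing_induction {motive : CoordRing K V → Prop}
    (algebraMap : ∀ r, motive (algebraMap K (CoordRing K V) r))
    (linForm : ∀ α, motive (linForm K V α))
    (mul : ∀ a b, motive a → motive b → motive (a * b))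
    (add : ∀ a b, motive a → motive b → motive (a + b)) (a : CoordRing K V) : motive a :=
  SymmetricAlgebra.induction (R := K) (M := Dual K V) (motive := motive)
    algebraMap linForm mul add a

theorem coordRing_algHom_ext {B : Type*} [CommRing B] [Algebra K B]
    {f g : CoordRing K V →ₐ[K] B} (h : ∀ α, f (linForm K V α) = g (linForm K V α)) : f = g :=
  SymmetricAlgebra.algHom_ext (R := K) (M := Dual K V) (LinearMap.ext h)

theorem derivation_ext {θ η : Derivation K (CoordRing K V) (CoordRing K V)}
    (h : ∀ α, θ (linForm K V α) = η (linForm K V α)) : θ = η := by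
  ext x
  induction x using coordRing_induction with
  | algebraMap r => simp
  | linForm α => exact h α
  | mul a b ha hb => simp [ha, hb]
  | add a b ha hb => simp [ha, hb]

/-- The derivation of `S(V*)` with prescribed values on the linear forms. -/
noncomputable def derivationOfLinearMap (f : Dual K V →ₗ[K] CoordRing K V) :
    Derivation K (CoordRing K V) (CoordRing K V) :=
  -- A derivation `D` amounts to an algebra homomorphism `x ↦ x + ε D x` into the dual numbers over
  -- `S`, and the latter is determined freely on linear forms.
  let φ : CoordRing K V →ₐ[K] TrivSqZeroExt (CoordRing K V) (CoordRing K V) :=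
    coordLift ((TrivSqZeroExt.inlAlgHom K (CoordRing K V) (CoordRing K V)).toLinearMap ∘ₗ
      linForm K V + (TrivSqZeroExt.inrHom (CoordRing K V) (CoordRing K V)).restrictScalars K ∘ₗ f)
  have hφ : ∀ x, (φ x).fst = x := fun x => by
    have : (TrivSqZeroExt.fstHom K (CoordRing K V) (CoordRing K V)).comp φ = AlgHom.id K _ :=
      coordRing_algHom_ext fun α => by simp [φ]
    exact congr($this x)
  Derivation.mk' ((TrivSqZeroExt.sndHom (CoordRing K V) (CoordRing K V)).restrictScalars K ∘ₗ
    φ.toLinearMap) fun a b => by simp [hφ, mul_comm]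

@[simp]
theorem derivationOfLinearMap_linForm (f : Dual K V →ₗ[K] CoordRing K V) (α : Dual K V) :
    derivationOfLinearMap f (linForm K V α) = f α := by
  simp [derivationOfLinearMap]

/-! ### The grading -/

/-- The homomorphism `S(V*) → S(V*)[T]` that sends `α ∈ V*` to `α T`. -/
noncomputable def gradingHom (K : Type u) [Field K] (V : Type v) [AddCommGroup V] [Module K V] :
    CoordRing K V →ₐ[K] Polynomial (CoordRing K V) :=
  coordLift ((Polynomial.monomial 1).restrictScalars K ∘ₗ linForm K V)

theorem gradingHom_linForm (α : Dual K V) :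
    gradingHom K V (linForm K V α) = Polynomial.monomial 1 (linForm K V α) := by
  simp [gradingHom]

theorem linForm_mem_homogComponent (α : Dual K V) :
    linForm K V α ∈ homogComponent K V 1 := by
  simp [homogComponent]

theorem mul_mem_homogComponent {x y : CoordRing K V} {m n : ℕ} (hx : x ∈ homogComponent K V m)
    (hy : y ∈ homogComponent K V n) : x * y ∈ homogComponent K V (m + n) := by
  rw [homogComponent, pow_add]
  exact Submodule.mul_mem_mul hx hy

theorem prod_linForm_mem_homogComponent {ι : Type*} (s : Finset ι) (f : ι → Dual K V) :
    ∏ i ∈ s, linForm K V (f i) ∈ homogComponent K V s.card := by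
  classical
  induction s using Finset.induction_on with
  | empty => simp [homogComponent]
  | insert a s ha ih =>
    rw [Finset.prod_insert ha, Finset.card_insert_of_notMem ha, add_comm]
    exact mul_mem_homogComponent (linForm_mem_homogComponent _) ih

theorem gradingHom_of_mem {n : ℕ} {x : CoordRing K V} (hx : x ∈ homogComponent K V n) :
    gradingHom K V x = Polynomial.monomial n x := by
  rw [homogComponent] at hx
  induction hx using Submodule.pow_induction_on_left' with
  | algebraMap r => simp [AlgHom.commutes]
  | add x y i hx hy ihx ihy => simp [ihx, ihy]
  | mem_mul m hm i x hx ih =>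
    obtain ⟨α, rfl⟩ := hm
    rw [map_mul, ih, gradingHom_linForm, Polynomial.monomial_mul_monomial, add_comm]

/-- The homogeneous part of degree `n`. -/
noncomputable def homogPart (n : ℕ) (x : CoordRing K V) : CoordRing K V :=
  (gradingHom K V x).coeff n

theorem homogPart_mem (n : ℕ) (x : CoordRing K V) : homogPart n x ∈ homogComponent K V n := by
  rw [homogPart]
  induction x using coordRing_induction generalizing n with
  | algebraMap r =>
    rw [AlgHom.commutes, Polynomial.algebraMap_apply, Polynomial.coeff_C]
    split_ifs with h
    · subst h; simp [homogComponent]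
    · simp
  | linForm α =>
    rw [gradingHom_linForm, Polynomial.coeff_monomial]
    split_ifs with h
    · subst h; exact linForm_mem_homogComponent α
    · simp
  | mul a b ha hb =>
    rw [map_mul, Polynomial.coeff_mul]
    refine Submodule.sum_mem _ fun p hp => ?_
    rw [← Finset.HasAntidiagonal.mem_antidiagonal.mp hp]
    exact mul_mem_homogComponent (ha _) (hb _)
  | add a b ha hb =>
    rw [map_add, Polynomial.coeff_add]
    exact Submodule.add_mem _ (ha n) (hb n)

theorem homogPart_of_mem {n : ℕ} {x : CoordRing K V} (hx : x ∈ homogComponent K V n) :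
    homogPart n x = x := by
  simp [homogPart, gradingHom_of_mem hx]

theorem homogPart_sum {ι : Type*} (n : ℕ) (s : Finset ι) (f : ι → CoordRing K V) :
    homogPart n (∑ i ∈ s, f i) = ∑ i ∈ s, homogPart n (f i) := by
  simp [homogPart]

theorem homogPart_mul_of_mem {n d : ℕ} (x : CoordRing K V) {y : CoordRing K V}
    (hy : y ∈ homogComponent K V d) :
    homogPart n (x * y) = if d ≤ n then homogPart (n - d) x * y else 0 := by
  rw [homogPart, map_mul, gradingHom_of_mem hy, ← Polynomial.C_mul_X_pow_eq_monomial,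
    ← mul_assoc, Polynomial.coeff_mul_X_pow', Polynomial.coeff_mul_C, homogPart]

theorem mem_homogComponent_zero {x : CoordRing K V} (hx : x ∈ homogComponent K V 0) :
    ∃ c : K, x = algebraMap K (CoordRing K V) c := by
  rw [homogComponent, pow_zero, Submodule.mem_one] at hx
  obtain ⟨c, hc⟩ := hx
  exact ⟨c, hc.symm⟩

/-! ### Restriction to a subspace -/

/-- The restriction homomorphism `S(V*) → S(X*)`. -/
noncomputable def resHom (X : Submodule K V) : CoordRing K V →ₐ[K] CoordRing K X :=
  coordLift (linForm K X ∘ₗ X.subtype.dualMap)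

@[simp]
theorem resHom_linForm (X : Submodule K V) (α : Dual K V) :
    resHom X (linForm K V α) = linForm K X (α ∘ₗ X.subtype) := by
  simp [resHom, LinearMap.dualMap_apply']

theorem linForm_injective : Function.Injective (linForm K V) := by
  rw [← LinearMap.ker_eq_bot, LinearMap.ker_eq_bot']
  intro α h
  ext v
  have := congr(coordLift (Dual.eval K V v) $h)
  simpa using this

theorem linForm_ne_zero {α : Dual K V} (hα : α ≠ 0) : linForm K V α ≠ 0 :=
  (map_ne_zero_iff _ linForm_injective).mpr hα

theorem resHom_surjective (X : Submodule K V) : Function.Surjective (resHom X) := by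
  obtain ⟨p, hp⟩ := X.subtype.exists_leftInverse_of_injective X.ker_subtype
  have h : (resHom X).comp (coordLift (linForm K V ∘ₗ p.dualMap)) = AlgHom.id K _ :=
    coordRing_algHom_ext fun α => by
      simp [LinearMap.dualMap_apply', LinearMap.comp_assoc, hp]
  exact fun x => ⟨_, congr($h x)⟩

/-- Restriction commutes with `gradingHom`, so the degree `n` part of an arbitrary preimage is again
a preimage. -/
theorem exists_homogComponent_resHom_eq {X : Submodule K V} {n : ℕ} {y : CoordRing K X}
    (hy : y ∈ homogComponent K X n) : ∃ x ∈ homogComponent K V n, resHom X x = y := by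
  obtain ⟨p, hp⟩ := X.subtype.exists_leftInverse_of_injective X.ker_subtype
  obtain ⟨x, hx⟩ := resHom_surjective X y
  refine ⟨homogPart n x, homogPart_mem n x, ?_⟩
  have h : (gradingHom K X).comp (resHom X) =
      (Polynomial.mapAlgHom (resHom X)).comp (gradingHom K V) :=
    coordRing_algHom_ext fun α => by simp [gradingHom_linForm]
  have h' := congr(($h x).coeff n)
  simp only [AlgHom.comp_apply, hx, gradingHom_of_mem hy, Polynomial.coeff_monomial_same,
    Polynomial.coe_mapAlgHom, Polynomial.coeff_map] at h'
  exact h'.symm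

theorem resHom_ker_eq_zero (α : Dual K V) : resHom (LinearMap.ker α) (linForm K V α) = 0 := by
  rw [resHom_linForm, show α ∘ₗ (LinearMap.ker α).subtype = 0 from
    LinearMap.ext fun x => x.2, map_zero]

theorem resHom_mem_homogComponent (X : Submodule K V) {n : ℕ} {x : CoordRing K V}
    (hx : x ∈ homogComponent K V n) : resHom X x ∈ homogComponent K X n := by
  have h : (homogComponent K V n).map (resHom X).toLinearMap ≤ homogComponent K X n := by
    rw [homogComponent, Submodule.map_pow, homogComponent]
    refine pow_le_pow_left' ?_ n
    rintro _ ⟨_, ⟨α, rfl⟩, rfl⟩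
    exact ⟨_, (resHom_linForm X α).symm⟩
  exact h ⟨x, hx, rfl⟩

/-- The kernel of the restriction to a hyperplane is generated by a defining linear form. -/
theorem resHom_ker_eq_zero_iff {α : Dual K V} (hα : α ≠ 0) (x : CoordRing K V) :
    resHom (LinearMap.ker α) x = 0 ↔ linForm K V α ∣ x := by
  refine ⟨fun hx => ?_, ?_⟩
  · obtain ⟨v, hv⟩ : ∃ v, α v = 1 := LinearMap.surjective hα 1
    -- `p` is the projection onto `ker α` along `v`. It induces a map `s` back to `S(V*)` for which
    -- `s ∘ resHom` is the identity modulo `α`, so an element restricting to zero is zero modulo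
    -- `α`.
    let p : V →ₗ[K] LinearMap.ker α :=
      (LinearMap.id - α.smulRight v).codRestrict _ fun w => by simp [hv]
    have hp : ∀ w, (p w : V) = w - α w • v := fun w => rfl
    let s : CoordRing K (LinearMap.ker α) →ₐ[K] CoordRing K V :=
      coordLift (linForm K V ∘ₗ p.dualMap)
    have h : (Ideal.Quotient.mkₐ K (Ideal.span {linForm K V α})).comp
        (s.comp (resHom (LinearMap.ker α))) =
        Ideal.Quotient.mkₐ K (Ideal.span {linForm K V α}) :=
      coordRing_algHom_ext fun β => by
        simp only [AlgHom.comp_apply, resHom_linForm, s, coordLift_linForm,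
          Ideal.Quotient.mkₐ_eq_mk]
        rw [eq_comm, Ideal.Quotient.eq, Ideal.mem_span_singleton, LinearMap.comp_apply, ← map_sub]
        have : β - p.dualMap (β ∘ₗ (LinearMap.ker α).subtype) = β v • α := by
          ext w; simp [hp, mul_comm]
        rw [this, map_smul]
        exact dvd_smul_of_dvd _ dvd_rfl
    have h' := congr($h x)
    simp only [AlgHom.comp_apply, hx, map_zero] at h'
    exact Ideal.mem_span_singleton.mp (Ideal.Quotient.eq_zero_iff_mem.mp h'.symm)
  · rintro ⟨y, rfl⟩
    rw [map_mul, resHom_ker_eq_zero, zero_mul]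

/-- The ideal generated by `α` is the kernel of a homomorphism to a domain. -/
theorem linForm_prime {α : Dual K V} (hα : α ≠ 0) : Prime (linForm K V α) := by
  refine ⟨linForm_ne_zero hα, fun hu => ?_, fun a b => ?_⟩
  · have := hu.map (resHom (LinearMap.ker α))
    rw [resHom_ker_eq_zero] at this
    exact not_isUnit_zero this
  · simp only [← resHom_ker_eq_zero_iff hα, map_mul, mul_eq_zero]
    exact id

theorem linForm_dvd_linForm_iff {α β : Dual K V} (hα : α ≠ 0) :
    linForm K V α ∣ linForm K V β ↔ LinearMap.ker α ≤ LinearMap.ker β := by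
  rw [← resHom_ker_eq_zero_iff hα, resHom_linForm, map_eq_zero_iff _ linForm_injective]
  refine ⟨fun h x hx => congr($h ⟨x, hx⟩), fun h => LinearMap.ext fun x => h x.2⟩

end CoordRing

/-! ### Linear forms and their kernels -/

section LinearForms

variable {K : Type u} [Field K] {V : Type v} [AddCommGroup V] [Module K V]

theorem exists_eq_smul_of_ker_le_ker {α β : Dual K V}
    (h : LinearMap.ker α ≤ LinearMap.ker β) : ∃ c : K, β = c • α := by
  by_cases hα : α = 0
  · subst hα
    exact ⟨0, LinearMap.ext fun x => by simpa using h (x := x) (by simp)⟩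
  · obtain ⟨v, hv⟩ : ∃ v, α v = 1 := LinearMap.surjective hα 1
    refine ⟨β v, LinearMap.ext fun w => ?_⟩
    have : w - α w • v ∈ LinearMap.ker β := h (by simp [hv])
    simpa [sub_eq_zero, mul_comm] using this

theorem exists_ker_eq_of_isCoatom {H : Submodule K V} (hH : IsCoatom H) :
    ∃ α : Dual K V, α ≠ 0 ∧ LinearMap.ker α = H := by
  obtain ⟨α, hα, hle⟩ := H.exists_le_ker_of_lt_top hH.lt_top
  refine ⟨α, hα, (hH.le_iff.mp hle).resolve_left fun h => hα ?_⟩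
  exact LinearMap.ker_eq_top.mp h

theorem ne_zero_of_ker_isCoatom {α : Dual K V} (h : IsCoatom (LinearMap.ker α)) : α ≠ 0 :=
  fun h0 => h.1 (LinearMap.ker_eq_top.mpr h0)

theorem dvd_derivation_of_ker_eq {θ : Derivation K (CoordRing K V) (CoordRing K V)}
    {α β : Dual K V} (h : LinearMap.ker α = LinearMap.ker β)
    (hα : linForm K V α ∣ θ (linForm K V α)) : linForm K V β ∣ θ (linForm K V β) := by
  obtain ⟨c, rfl⟩ := exists_eq_smul_of_ker_le_ker h.le
  obtain ⟨g, hg⟩ := hα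
  exact ⟨g, by rw [map_smul, Derivation.map_smul, hg, smul_mul_assoc]⟩

end LinearForms

/-! ### Derivations, their restriction to a hyperplane, and homogeneity -/

section Derivations

variable {K : Type u} [Field K] {V : Type v} [AddCommGroup V] [Module K V]

theorem exists_eq_smul_derivation {a : CoordRing K V} (ha : a ≠ 0)
    {θ : Derivation K (CoordRing K V) (CoordRing K V)} (h : ∀ x, a ∣ θ x) :
    ∃ η : Derivation K (CoordRing K V) (CoordRing K V), θ = a • η := by
  choose f hf using h
  refine ⟨Derivation.mk' { toFun := f, map_add' := ?_, map_smul' := ?_ } ?_, ?_⟩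
  · intro x y
    apply mul_left_cancel₀ ha
    rw [mul_add, ← hf, ← hf, ← hf, map_add]
  · intro c x
    apply mul_left_cancel₀ ha
    rw [RingHom.id_apply, mul_smul_comm, ← hf, ← hf, Derivation.map_smul]
  · intro x y
    apply mul_left_cancel₀ ha
    change a * f (x * y) = a * (x • f y + y • f x)
    rw [mul_add, mul_smul_comm, mul_smul_comm, ← hf, ← hf, ← hf, Derivation.leibniz]
  · ext x
    exact hf x

/-- A derivation preserving the ideal of a hyperplane restricts to the hyperplane. -/
theorem exists_restrict_derivation {α : Dual K V}
    {θ : Derivation K (CoordRing K V) (CoordRing K V)}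
    (h : resHom (LinearMap.ker α) (θ (linForm K V α)) = 0) :
    ∃ η : Derivation K (CoordRing K (LinearMap.ker α)) (CoordRing K (LinearMap.ker α)),
      ∀ x, η (resHom _ x) = resHom _ (θ x) := by
  obtain ⟨p, hp⟩ := (LinearMap.ker α).subtype.exists_leftInverse_of_injective
    (LinearMap.ker α).ker_subtype
  refine ⟨derivationOfLinearMap ((resHom (LinearMap.ker α)).toLinearMap ∘ₗ
    θ.toLinearMap ∘ₗ linForm K V ∘ₗ p.dualMap), fun x => ?_⟩
  induction x using coordRing_induction with
  | algebraMap r => simp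
  | linForm β =>
    -- Two extensions of a form on the hyperplane differ by a multiple of `α`, and `θ(α)` vanishes
    -- there; so the choice of the retraction `p` does not affect the result.
    obtain ⟨c, hc⟩ : ∃ c : K, β - p.dualMap (β ∘ₗ (LinearMap.ker α).subtype) = c • α := by
      refine exists_eq_smul_of_ker_le_ker fun x hx => ?_
      have : p x = ⟨x, hx⟩ := congr($hp ⟨x, hx⟩)
      simp [this]
    have h' : resHom (LinearMap.ker α) (θ (linForm K V (β - p.dualMap
        (β ∘ₗ (LinearMap.ker α).subtype)))) = 0 := by
      rw [hc, map_smul, Derivation.map_smul, map_smul, h, smul_zero]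
    rw [map_sub, map_sub, map_sub, sub_eq_zero] at h'
    simp [h']
  | mul a b ha hb => simp [ha, hb]
  | add a b ha hb => simp [ha, hb]

theorem isHomogDerivation_restrict {X : Submodule K V}
    {θ : Derivation K (CoordRing K V) (CoordRing K V)}
    {η : Derivation K (CoordRing K X) (CoordRing K X)}
    (h : ∀ x, η (resHom X x) = resHom X (θ x)) {d : ℕ} (hθ : IsHomogDerivation θ d) :
    IsHomogDerivation η d := by
  intro β
  obtain ⟨p, hp⟩ := X.subtype.exists_leftInverse_of_injective X.ker_subtype
  have : linForm K X β = resHom X (linForm K V (β ∘ₗ p)) := by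
    rw [resHom_linForm, LinearMap.comp_assoc, hp, LinearMap.comp_id]
  rw [this, h]
  exact resHom_mem_homogComponent X (hθ _)

theorem mem_deletion_hyps {A : HypArrangement K V} {H₀ H : Submodule K V} :
    H ∈ (A.deletion H₀).hyps ↔ H ≠ H₀ ∧ H ∈ A.hyps := by
  simp [deletion]

theorem mem_restriction_hyps {A : HypArrangement K V} {X : Submodule K V} {Y : Submodule K X} :
    Y ∈ (A.restriction X).hyps ↔ ∃ H ∈ A.hyps, ¬ X ≤ H ∧ H.comap X.subtype = Y := by
  simp [restriction, and_assoc]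

theorem mem_derivationModule_of_deletion {A : HypArrangement K V} {α : Dual K V}
    (hα : α ≠ 0) {θ : Derivation K (CoordRing K V) (CoordRing K V)}
    (hθ : θ ∈ (A.deletion (LinearMap.ker α)).derivationModule)
    (h : resHom (LinearMap.ker α) (θ (linForm K V α)) = 0) : θ ∈ A.derivationModule := by
  intro H hH β hβ
  by_cases hHα : H = LinearMap.ker α
  · exact dvd_derivation_of_ker_eq (hβ.trans hHα).symm ((resHom_ker_eq_zero_iff hα _).mp h)
  · exact hθ H (mem_deletion_hyps.mpr ⟨hHα, hH⟩) β hβ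

theorem derivationModule_le_deletion (A : HypArrangement K V) (H₀ : Submodule K V) :
    A.derivationModule ≤ (A.deletion H₀).derivationModule :=
  fun _ hθ H hH => hθ H (mem_deletion_hyps.mp hH).2

theorem resHom_apply_eq_zero {A : HypArrangement K V} {α : Dual K V} (hα : α ≠ 0)
    (hA : LinearMap.ker α ∈ A.hyps) {θ : Derivation K (CoordRing K V) (CoordRing K V)}
    (hθ : θ ∈ A.derivationModule) : resHom (LinearMap.ker α) (θ (linForm K V α)) = 0 :=
  (resHom_ker_eq_zero_iff hα _).mpr (hθ _ hA α rfl)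

theorem restrict_mem_derivationModule {A : HypArrangement K V} {X : Submodule K V}
    {θ : Derivation K (CoordRing K V) (CoordRing K V)} (hθ : θ ∈ A.derivationModule)
    {η : Derivation K (CoordRing K X) (CoordRing K X)}
    (h : ∀ x, η (resHom X x) = resHom X (θ x)) : η ∈ (A.restriction X).derivationModule := by
  intro Y hY β hβ
  obtain ⟨H, hH, -, rfl⟩ := mem_restriction_hyps.mp hY
  obtain ⟨γ, -, rfl⟩ := exists_ker_eq_of_isCoatom (A.isCoatom H hH)
  refine dvd_derivation_of_ker_eq (α := γ ∘ₗ X.subtype) (by rw [hβ, LinearMap.ker_comp]) ?_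
  rw [← resHom_linForm, h]
  exact map_dvd _ (hθ _ hH γ rfl)

/-- If `α D ∈ D(A')` for the deleted linear form `α`, then `D ∈ D(A')`. -/
theorem mem_derivationModule_of_smul_mem {A : HypArrangement K V} {α : Dual K V}
    (hα : α ≠ 0) {η : Derivation K (CoordRing K V) (CoordRing K V)}
    (h : linForm K V α • η ∈ (A.deletion (LinearMap.ker α)).derivationModule) :
    η ∈ (A.deletion (LinearMap.ker α)).derivationModule := by
  rintro _ hH β rfl
  obtain ⟨hne, hA⟩ := mem_deletion_hyps.mp hH
  have hβ := ne_zero_of_ker_isCoatom (A.isCoatom _ hA)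
  -- The prime `β` divides `α η(β)`; it does not divide `α`, since their kernels are distinct
  -- hyperplanes.
  refine ((linForm_prime hβ).dvd_mul.mp (h _ hH β rfl)).resolve_left fun hdvd => hne ?_
  rw [linForm_dvd_linForm_iff hβ] at hdvd
  exact (((A.isCoatom _ hA).le_iff.mp hdvd).resolve_left
    fun h => hα (LinearMap.ker_eq_top.mp h)).symm

/-- A homogeneous derivation is a combination of the basis elements of no larger degree. -/
theorem mem_span_of_isHomogDerivation {ι : Type*} [Fintype ι] {A : HypArrangement K V}
    (b : Basis ι (CoordRing K V) A.derivationModule) {d : ι → ℕ}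
    (hd : ∀ i, IsHomogDerivation (b i : Derivation K (CoordRing K V) (CoordRing K V)) (d i))
    {θ : Derivation K (CoordRing K V) (CoordRing K V)} (hθ : θ ∈ A.derivationModule) {e n : ℕ}
    (he : IsHomogDerivation θ e) (hen : e ≤ n) :
    θ ∈ Submodule.span (CoordRing K V) (Set.range fun i : {i // d i ≤ n} =>
      (b i : Derivation K (CoordRing K V) (CoordRing K V))) := by
  have hsum : θ = ∑ i, b.repr ⟨θ, hθ⟩ i • (b i : Derivation K (CoordRing K V) (CoordRing K V)) := by
    have := congr(A.derivationModule.subtype $(b.sum_repr ⟨θ, hθ⟩))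
    simp only [map_sum, map_smul, Submodule.subtype_apply] at this
    exact this.symm
  -- Taking parts of degree `e` replaces each coefficient by its part of degree `e - d i`, and
  -- removes the terms with `d i > e`.
  have key : θ = ∑ i, (if d i ≤ e then homogPart (e - d i) (b.repr ⟨θ, hθ⟩ i) else 0) •
      (b i : Derivation K (CoordRing K V) (CoordRing K V)) := by
    refine derivation_ext fun α => ?_
    have h1 := congr(homogPart e ($hsum (linForm K V α)))
    rw [homogPart_of_mem (he α)] at h1
    rw [h1, ← Derivation.coeFnAddMonoidHom_apply, ← Derivation.coeFnAddMonoidHom_apply, map_sum,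
      map_sum, Finset.sum_apply, Finset.sum_apply, homogPart_sum]
    refine Finset.sum_congr rfl fun i _ => ?_
    simp only [Derivation.coeFnAddMonoidHom_apply, Derivation.smul_apply, smul_eq_mul]
    rw [homogPart_mul_of_mem _ (hd i α)]
    split_ifs <;> simp
  rw [key]
  refine Submodule.sum_mem _ fun i _ => ?_
  split_ifs with hi
  · exact Submodule.smul_mem _ _ (Submodule.subset_span ⟨⟨i, hi.trans hen⟩, rfl⟩)
  · simp

end Derivations

/-! ### The addition theorem -/

section Addition

variable {K : Type u} [Field K] {V : Type v} [AddCommGroup V] [Module K V]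

/-- The restrictions to a hyperplane of basis elements of `D(A')` are linearly independent. -/
theorem linearIndependent_restrict {A : HypArrangement K V} {α : Dual K V} (hα : α ≠ 0)
    {ι κ : Type*} [Fintype κ]
    (b : Basis ι (CoordRing K V) (A.deletion (LinearMap.ker α)).derivationModule)
    (f : κ → ι) (hf : Function.Injective f)
    (η : κ → Derivation K (CoordRing K (LinearMap.ker α)) (CoordRing K (LinearMap.ker α)))
    (hη : ∀ i x, η i (resHom _ x) =
      resHom _ ((b (f i) : Derivation K (CoordRing K V) (CoordRing K V)) x)) :
    LinearIndependent (CoordRing K (LinearMap.ker α)) η := by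
  classical
  rw [Fintype.linearIndependent_iff]
  intro g hg i
  choose c hc using fun i => resHom_surjective (LinearMap.ker α) (g i)
  -- A relation on the hyperplane lifts to a combination whose values are all divisible by `α`. The
  -- quotient lies in `D(A')`, so comparing coordinates in `b` shows that `α` divides each lifted
  -- coefficient.
  obtain ⟨θ, hθ⟩ : ∃ θ : Derivation K (CoordRing K V) (CoordRing K V),
      ((∑ i, c i • b (f i) : (A.deletion (LinearMap.ker α)).derivationModule) :
        Derivation K (CoordRing K V) (CoordRing K V)) = linForm K V α • θ := by
    refine exists_eq_smul_derivation (linForm_ne_zero hα) fun x => ?_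
    rw [← resHom_ker_eq_zero_iff hα]
    have h := congr($hg (resHom _ x))
    rw [← Derivation.coeFnAddMonoidHom_apply, map_sum, Finset.sum_apply] at h
    rw [AddSubmonoidClass.coe_finsetSum, ← Derivation.coeFnAddMonoidHom_apply, map_sum,
      Finset.sum_apply, map_sum]
    simpa [hη, hc] using h
  have hθ' : θ ∈ (A.deletion (LinearMap.ker α)).derivationModule := by
    apply mem_derivationModule_of_smul_mem hα
    rw [← hθ]
    exact Subtype.property _
  have hsum : ∑ i, c i • b (f i) = linForm K V α •
      (⟨θ, hθ'⟩ : (A.deletion (LinearMap.ker α)).derivationModule) := Subtype.ext hθ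
  have h := congr(b.repr $hsum (f i))
  rw [map_sum, Finsupp.finsetSum_apply, Finset.sum_eq_single i] at h
  · rw [← hc, resHom_ker_eq_zero_iff hα]
    exact ⟨b.repr ⟨θ, hθ'⟩ (f i), by
      rw [map_smul, map_smul, Basis.repr_self] at h
      simpa using h⟩
  · intro j _ hj
    simp [hf.ne hj]
  · simp

/-- Changing a basis of `D(A')` into a basis of `D(A)`. -/
theorem exists_basis_of_deletion {A : HypArrangement K V} {α : Dual K V} (hα : α ≠ 0)
    (hA : LinearMap.ker α ∈ A.hyps) {ι : Type*} [Fintype ι] [DecidableEq ι]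
    (b : Basis ι (CoordRing K V) (A.deletion (LinearMap.ker α)).derivationModule) (k : ι)
    (hk : resHom (LinearMap.ker α)
      ((b k : Derivation K (CoordRing K V) (CoordRing K V)) (linForm K V α)) ≠ 0)
    (f : ι → CoordRing K V)
    (hf : ∀ j, resHom (LinearMap.ker α)
      ((b j : Derivation K (CoordRing K V) (CoordRing K V)) (linForm K V α)) =
        resHom (LinearMap.ker α) (f j *
          (b k : Derivation K (CoordRing K V) (CoordRing K V)) (linForm K V α))) :
    ∃ b' : Basis ι (CoordRing K V) A.derivationModule, ∀ j,
      (b' j : Derivation K (CoordRing K V) (CoordRing K V)) =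
        if j = k then linForm K V α • (b k : Derivation K (CoordRing K V) (CoordRing K V))
        else (b j : Derivation K (CoordRing K V) (CoordRing K V)) -
          f j • (b k : Derivation K (CoordRing K V) (CoordRing K V)) := by
  set θ : ι → Derivation K (CoordRing K V) (CoordRing K V) := fun j => b j with hθ
  set ψ : ι → Derivation K (CoordRing K V) (CoordRing K V) := fun j =>
    if j = k then linForm K V α • θ k else θ j - f j • θ k with hψ
  have hψA : ∀ j, ψ j ∈ A.derivationModule := by
    intro j
    apply mem_derivationModule_of_deletion hα
    · simp only [hψ]
      split_ifs
      · exact Submodule.smul_mem _ _ (b k).2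
      · exact Submodule.sub_mem _ (b j).2 (Submodule.smul_mem _ _ (b k).2)
    · simp only [hψ]
      split_ifs
      · rw [Derivation.smul_apply, smul_eq_mul, map_mul, resHom_ker_eq_zero, zero_mul]
      · simp only [Derivation.sub_apply, Derivation.smul_apply, smul_eq_mul, map_sub, sub_eq_zero]
        exact hf j
  have hli : LinearIndependent (CoordRing K V) θ :=
    b.linearIndependent.map' (Submodule.subtype _) (Submodule.ker_subtype _)
  -- Rewriting a combination of the `ψ j` in terms of the `θ j` changes only the coefficient at `k`;
  -- both independence and spanning are read off from this.
  have hsum : ∀ g : ι → CoordRing K V, ∑ j, g j • ψ j = ∑ j, Function.update g k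
      (linForm K V α * g k - ∑ j ∈ Finset.univ.erase k, g j * f j) j • θ j := by
    intro g
    rw [← Finset.add_sum_erase _ _ (Finset.mem_univ k),
      ← Finset.add_sum_erase _ (fun j => Function.update _ _ _ j • θ j) (Finset.mem_univ k)]
    have h1 : ∑ j ∈ Finset.univ.erase k, g j • ψ j =
        ∑ j ∈ Finset.univ.erase k, (g j • θ j - (g j * f j) • θ k) :=
      Finset.sum_congr rfl fun j hj => by
        simp [hψ, Finset.ne_of_mem_erase hj, smul_sub, mul_smul]
    have h2 : ∑ j ∈ Finset.univ.erase k, Function.update g k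
        (linForm K V α * g k - ∑ j ∈ Finset.univ.erase k, g j * f j) j • θ j =
        ∑ j ∈ Finset.univ.erase k, g j • θ j :=
      Finset.sum_congr rfl fun j hj => by
        rw [Function.update_of_ne (Finset.ne_of_mem_erase hj)]
    rw [h1, h2, Finset.sum_sub_distrib, ← Finset.sum_smul, Function.update_self, sub_smul]
    simp only [hψ, if_true, smul_smul, mul_comm (g k)]
    abel
  have hψli : LinearIndependent (CoordRing K V) ψ := by
    rw [Fintype.linearIndependent_iff] at hli ⊢
    intro g hg
    rw [hsum] at hg
    have h := hli _ hg
    have hne : ∀ j ≠ k, g j = 0 := fun j hj => by simpa [hj] using h j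
    intro j
    by_cases hj : j = k
    · subst hj
      have hk' := h j
      rw [Function.update_self, Finset.sum_eq_zero, sub_zero, mul_eq_zero] at hk'
      · exact hk'.resolve_left (linForm_ne_zero hα)
      · intro i hi
        rw [hne i (Finset.ne_of_mem_erase hi), zero_mul]
    · exact hne j hj
  have hspan : ∀ η ∈ A.derivationModule, ∃ g : ι → CoordRing K V, ∑ j, g j • ψ j = η := by
    intro η hη
    have hη' := derivationModule_le_deletion A (LinearMap.ker α) hη
    obtain ⟨c, hc⟩ : ∃ c : ι → CoordRing K V, η = ∑ j, c j • θ j := by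
      refine ⟨b.repr ⟨η, hη'⟩, ?_⟩
      have := congr(Submodule.subtype _ $(b.sum_repr ⟨η, hη'⟩))
      simp only [map_sum, map_smul, Submodule.subtype_apply] at this
      exact this.symm
    have h0 := resHom_apply_eq_zero hα hA hη
    rw [hc, ← Derivation.coeFnAddMonoidHom_apply, map_sum, Finset.sum_apply, map_sum,
      ← Finset.add_sum_erase _ _ (Finset.mem_univ k)] at h0
    have h1 : ∑ j ∈ Finset.univ.erase k, resHom (LinearMap.ker α)
        (Derivation.coeFnAddMonoidHom (c j • θ j) (linForm K V α)) =
        resHom (LinearMap.ker α) ((∑ j ∈ Finset.univ.erase k, c j * f j) *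
          θ k (linForm K V α)) := by
      rw [Finset.sum_mul, map_sum]
      refine Finset.sum_congr rfl fun j _ => ?_
      have := hf j
      simp only [map_mul] at this
      simp [hθ, this, mul_assoc]
    rw [h1, Derivation.coeFnAddMonoidHom_apply, Derivation.smul_apply, smul_eq_mul, ← map_add,
      ← add_mul, map_mul] at h0
    -- On the hyperplane, `(c k + ∑ c j f j) θ_k(α) = 0`; cancelling `θ_k(α)` makes the bracket a
    -- multiple `α r`, and `r` is the coefficient of `α θ_k`.
    obtain ⟨r, hr⟩ := (resHom_ker_eq_zero_iff hα _).mp ((mul_eq_zero.mp h0).resolve_right hk)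
    refine ⟨Function.update c k r, ?_⟩
    rw [hsum, hc]
    refine Finset.sum_congr rfl fun j _ => ?_
    by_cases hj : j = k
    · subst hj
      have h2 : ∑ i ∈ Finset.univ.erase j, Function.update c j r i * f i =
          ∑ i ∈ Finset.univ.erase j, c i * f i :=
        Finset.sum_congr rfl fun i hi => by
          rw [Function.update_of_ne (Finset.ne_of_mem_erase hi)]
      rw [Function.update_self, Function.update_self, h2, ← hr, add_sub_cancel_right]
    · rw [Function.update_of_ne hj, Function.update_of_ne hj]
  refine ⟨Basis.mk (v := fun j => (⟨ψ j, hψA j⟩ : A.derivationModule)) ?_ ?_, fun j => ?_⟩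
  · exact LinearIndependent.of_comp (Submodule.subtype _) hψli
  · rintro ⟨η, hη⟩ -
    obtain ⟨g, hg⟩ := hspan η hη
    have : (⟨η, hη⟩ : A.derivationModule) = ∑ j, g j • ⟨ψ j, hψA j⟩ :=
      Subtype.ext (by simp [← hg])
    rw [this]
    exact Submodule.sum_mem _ fun j _ =>
      Submodule.smul_mem _ _ (Submodule.subset_span ⟨j, rfl⟩)
  · rw [Basis.mk_apply]

/-- The addition theorem, for a form `B` on the hyperplane `H₀ = ker α` that divides the
restriction to `H₀` of `θ(α)` for all `θ ∈ D(A')`. -/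
theorem isFreeWithExponents_of_deletion_of_restriction {A : HypArrangement K V} {α : Dual K V}
    [FiniteDimensional K V]
    (hα : α ≠ 0) (hA : LinearMap.ker α ∈ A.hyps) {B : CoordRing K (LinearMap.ker α)} {n : ℕ}
    (hBn : B ∈ homogComponent K (LinearMap.ker α) n)
    (hdvd : ∀ θ ∈ (A.deletion (LinearMap.ker α)).derivationModule,
      B ∣ resHom (LinearMap.ker α) (θ (linForm K V α)))
    {m : Multiset ℕ} (hres : (A.restriction (LinearMap.ker α)).IsFreeWithExponents m)
    (hdel : (A.deletion (LinearMap.ker α)).IsFreeWithExponents (n ::ₘ m)) :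
    A.IsFreeWithExponents ((n + 1) ::ₘ m) := by
  obtain ⟨b, d, hd, hm⟩ := hdel
  obtain ⟨φ, e, he, rfl⟩ := hres
  choose h hh using fun i => hdvd (b i) (b i).2
  -- As `B` is homogeneous of degree `n`, the quotient can be taken homogeneous of degree `d i - n`,
  -- and the value vanishes when `d i < n`.
  have hpart : ∀ i, resHom (LinearMap.ker α)
      ((b i : Derivation K (CoordRing K V) (CoordRing K V)) (linForm K V α)) =
        if n ≤ d i then homogPart (d i - n) (h i) * B else 0 := by
    intro i
    rw [← homogPart_mul_of_mem _ hBn, mul_comm, ← hh,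
      homogPart_of_mem (resHom_mem_homogComponent _ (hd i α))]
  obtain ⟨k, hkn, hk⟩ : ∃ k, d k = n ∧ resHom (LinearMap.ker α)
      ((b k : Derivation K (CoordRing K V) (CoordRing K V)) (linForm K V α)) ≠ 0 := by
    by_contra! hcon
    have hzero : ∀ i : {i // d i ≤ n}, resHom (LinearMap.ker α)
        ((b i : Derivation K (CoordRing K V) (CoordRing K V)) (linForm K V α)) = 0 := by
      rintro ⟨i, hi⟩
      rcases hi.lt_or_eq with hi | hi
      · rw [hpart, if_neg hi.not_ge]
      · exact hcon i hi
    choose η hη using fun i => exists_restrict_derivation (hzero i)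
    have hli := linearIndependent_restrict hα b _ Subtype.val_injective η hη
    have hspan := fun i => mem_span_of_isHomogDerivation φ he
      (restrict_mem_derivationModule (mem_derivationModule_of_deletion hα (b i.1).2 (hzero i))
        (hη i)) (isHomogDerivation_restrict (hη i) (hd i.1)) i.2
    classical
    have hcard := linearIndependent_le_span_aux' η hli _ (Set.range_subset_iff.mpr hspan)
    have hcard' := hcard.trans (Fintype.card_range_le _)
    -- By `hm`, `d` takes values at most `n` exactly once more often than `e` does, against the rank
    -- bound.
    have h1 := congr(Multiset.countP (· ≤ n) $hm)
    rw [Multiset.countP_cons_of_pos (p := (· ≤ n)) _ le_rfl, Multiset.countP_map,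
      Multiset.countP_map] at h1
    rw [Fintype.card_subtype, Fintype.card_subtype] at hcard'
    exact absurd hcard' (by simp only [Finset.card_def, Finset.filter_val]; omega)
  obtain ⟨c, hc⟩ := mem_homogComponent_zero (homogPart_mem 0 (h k))
  have hkc : resHom (LinearMap.ker α)
      ((b k : Derivation K (CoordRing K V) (CoordRing K V)) (linForm K V α)) = c • B := by
    rw [hpart, if_pos hkn.ge, hkn, Nat.sub_self, hc, Algebra.smul_def]
  have hc0 : c ≠ 0 := by
    rintro rfl
    exact hk (by rw [hkc, zero_smul])
  -- The multiplier has degree `d j - n`, so that `θ_j - f θ_k` stays homogeneous of degree `d j`.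
  -- Stating this through products with elements of `S_n` also covers `d j < n`, where `f = 0`.
  have hf : ∀ j, ∃ f : CoordRing K V,
      (∀ y ∈ homogComponent K V n, f * y ∈ homogComponent K V (d j)) ∧
      resHom (LinearMap.ker α)
        ((b j : Derivation K (CoordRing K V) (CoordRing K V)) (linForm K V α)) =
          resHom (LinearMap.ker α) (f *
            (b k : Derivation K (CoordRing K V) (CoordRing K V)) (linForm K V α)) := by
    intro j
    by_cases hj : n ≤ d j
    · obtain ⟨f, hf, hfr⟩ := exists_homogComponent_resHom_eq (V := V)
        (Submodule.smul_mem _ c⁻¹ (homogPart_mem (d j - n) (h j)))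
      refine ⟨f, fun y hy => ?_, ?_⟩
      · have := mul_mem_homogComponent hf hy
        rwa [Nat.sub_add_cancel hj] at this
      · rw [map_mul, hkc, hfr, hpart, if_pos hj, smul_mul_smul_comm, inv_mul_cancel₀ hc0, one_smul]
    · refine ⟨0, fun y _ => by simp, ?_⟩
      rw [hpart, if_neg hj, zero_mul, map_zero]
  choose f hfd hf using hf
  obtain ⟨b', hb'⟩ := exists_basis_of_deletion hα hA b k hk f hf
  refine ⟨b', Function.update d k (n + 1), fun j β => ?_, ?_⟩
  · rw [hb']
    split_ifs with hj
    · subst hj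
      rw [Function.update_self, Derivation.smul_apply, smul_eq_mul, add_comm, ← hkn]
      exact mul_mem_homogComponent (linForm_mem_homogComponent α) (hd j β)
    · rw [Function.update_of_ne hj, Derivation.sub_apply, Derivation.smul_apply, smul_eq_mul]
      exact Submodule.sub_mem _ (hd j β) (hfd j _ (hkn ▸ hd k β))
  · have hu : k ::ₘ (Finset.univ.erase k).val = Finset.univ.val := by
      rw [Finset.erase_val, Multiset.cons_erase (Finset.mem_univ_val k)]
    rw [← hu, Multiset.map_cons, hkn, Multiset.cons_inj_right] at hm
    rw [hm, ← hu, Multiset.map_cons, Function.update_self, Multiset.cons_inj_right]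
    exact Multiset.map_congr rfl fun j hj =>
      (Function.update_of_ne (Finset.ne_of_mem_erase (Finset.mem_val.mp hj)) _ _).symm

end Addition

/-! ### Divisibility coming from a block, and the empty arrangement -/

section Factorization

variable {K : Type u} [Field K] {V : Type v} [AddCommGroup V] [Module K V]

theorem isRelPrime_linForm {α β : Dual K V} (hα : IsCoatom (LinearMap.ker α))
    (hβ : IsCoatom (LinearMap.ker β)) (h : LinearMap.ker α ≠ LinearMap.ker β) :
    IsRelPrime (linForm K V α) (linForm K V β) := by
  have hα0 := ne_zero_of_ker_isCoatom hα
  rw [(linForm_prime hα0).irreducible.isRelPrime_iff_not_dvd, linForm_dvd_linForm_iff hα0]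
  exact fun hle => (hα.le_iff.mp hle).elim hβ.1 fun h' => h h'.symm

/-- If `α_H` is a combination of `α₁` and `α` modulo which it is not proportional to `α₁`, and
`θ(α₁) = g α₁`, then `α_H` divides `θ(α) - g α` as soon as it divides `θ(α_H)`. -/
theorem linForm_dvd_derivation_sub {θ : Derivation K (CoordRing K V) (CoordRing K V)}
    {α α₁ β : Dual K V} {g : CoordRing K V} (hg : θ (linForm K V α₁) = linForm K V α₁ * g)
    (hβ : linForm K V β ∣ θ (linForm K V β)) {c d : K} (hd : d ≠ 0) (h : β = c • α₁ + d • α) :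
    linForm K V β ∣ θ (linForm K V α) - linForm K V α * g := by
  -- The expression `θ(x) - x g` is linear in `x ∈ V*` and vanishes at `α₁`.
  have h1 : θ (linForm K V β) - linForm K V β * g =
      d • (θ (linForm K V α) - linForm K V α * g) := by
    rw [h, map_add, map_smul, map_smul, map_add, Derivation.map_smul, Derivation.map_smul, hg,
      add_mul, smul_mul_assoc, smul_mul_assoc, smul_sub]
    abel
  have h2 : linForm K V β ∣ d • (θ (linForm K V α) - linForm K V α * g) :=
    h1 ▸ dvd_sub hβ (dvd_mul_right _ _)
  simpa [smul_smul, hd] using dvd_smul_of_dvd d⁻¹ h2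

theorem not_le_of_mem_of_ne {A : HypArrangement K V} {H H' : Submodule K V} (hH : H ∈ A.hyps)
    (hH' : H' ∈ A.hyps) (h : H' ≠ H) : ¬ H ≤ H' := fun hle =>
  ((A.isCoatom H hH).le_iff.mp hle).elim (A.isCoatom H' hH').1 h

open scoped Classical in
/-- If every element of `A''` is the restriction of a hyperplane outside `P ∋ H₀`, then the
restriction to `H₀` of `θ(α_{H₀})` is, for `θ ∈ D(A')`, divisible by the product of the
restrictions of the forms defining the hyperplanes in `P \ {H₀}`. -/
theorem prod_resHom_dvd {A : HypArrangement K V} {α : Dual K V}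
    (hA : LinearMap.ker α ∈ A.hyps) {P : Finset (Submodule K V)} (hPA : P ⊆ A.hyps)
    (hP : LinearMap.ker α ∈ P)
    (hsurj : Set.SurjOn (fun H : Submodule K V => H.comap (LinearMap.ker α).subtype)
      (↑(A.hyps \ P) : Set (Submodule K V))
      (↑(A.restriction (LinearMap.ker α)).hyps : Set (Submodule K (LinearMap.ker α))))
    {form : Submodule K V → Dual K V} (hform : ∀ H ∈ A.hyps, LinearMap.ker (form H) = H)
    {θ : Derivation K (CoordRing K V) (CoordRing K V)}
    (hθ : θ ∈ (A.deletion (LinearMap.ker α)).derivationModule) :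
    ∏ H ∈ P.erase (LinearMap.ker α), resHom (LinearMap.ker α) (linForm K V (form H)) ∣
      resHom (LinearMap.ker α) (θ (linForm K V α)) := by
  have hmaps : ∀ H ∈ P.erase (LinearMap.ker α), H.comap (LinearMap.ker α).subtype ∈
      (A.restriction (LinearMap.ker α)).hyps := fun H hH =>
    mem_restriction_hyps.mpr ⟨H, hPA (Finset.mem_of_mem_erase hH),
      not_le_of_mem_of_ne hA (hPA (Finset.mem_of_mem_erase hH)) (Finset.ne_of_mem_erase hH), rfl⟩
  have hcomap : ∀ H ∈ A.hyps, LinearMap.ker (form H ∘ₗ (LinearMap.ker α).subtype) =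
      H.comap (LinearMap.ker α).subtype := fun H hH => by
    rw [LinearMap.ker_comp, hform H hH]
  -- The product is grouped by the restriction `X` of `H` to `ker α`. Distinct `X` give coprime
  -- factors on `ker α`; within one group the restricted forms are proportional, so there
  -- divisibility must be proved in `S(V*)` before restricting.
  rw [← Finset.prod_fiberwise_of_maps_to hmaps]
  refine Finset.prod_dvd_of_isRelPrime ?_ ?_
  · intro X _ Y _ hXY
    refine IsRelPrime.prod_left fun H h => IsRelPrime.prod_right fun H' h' => ?_
    obtain ⟨hH, rfl⟩ := Finset.mem_filter.mp h
    obtain ⟨hH', rfl⟩ := Finset.mem_filter.mp h'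
    have e1 := hcomap H (hPA (Finset.mem_of_mem_erase hH))
    have e2 := hcomap H' (hPA (Finset.mem_of_mem_erase hH'))
    rw [resHom_linForm, resHom_linForm]
    refine isRelPrime_linForm ?_ ?_ ?_
    · rw [e1]; exact (A.restriction _).isCoatom _ (hmaps H hH)
    · rw [e2]; exact (A.restriction _).isCoatom _ (hmaps H' hH')
    · rw [e1, e2]; exact hXY
  · intro X hX
    obtain ⟨H₁, hH₁, rfl⟩ := hsurj hX
    obtain ⟨hH₁A, hH₁P⟩ := Finset.mem_sdiff.mp (Finset.mem_coe.mp hH₁)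
    -- `H₁` lies outside `P` and has restriction `X`. Its quotient `g` serves all `H` in the group
    -- at once: each `α_H` divides `θ(α) - α g`, which restricts to `θ(α)`.
    obtain ⟨g, hg⟩ := hθ H₁ (mem_deletion_hyps.mpr ⟨fun h => hH₁P (h ▸ hP), hH₁A⟩) (form H₁)
      (hform H₁ hH₁A)
    have hdvd : ∏ H ∈ P.erase (LinearMap.ker α) with
        H.comap (LinearMap.ker α).subtype = H₁.comap (LinearMap.ker α).subtype,
        linForm K V (form H) ∣ θ (linForm K V α) - linForm K V α * g := by
      refine Finset.prod_dvd_of_isRelPrime ?_ ?_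
      · intro H hH H' hH' hne
        have hHA := hPA (Finset.mem_of_mem_erase (Finset.mem_filter.mp hH).1)
        have hHA' := hPA (Finset.mem_of_mem_erase (Finset.mem_filter.mp hH').1)
        refine isRelPrime_linForm ?_ ?_ ?_
        · rw [hform H hHA]; exact A.isCoatom H hHA
        · rw [hform H' hHA']; exact A.isCoatom H' hHA'
        · rw [hform H hHA, hform H' hHA']; exact hne
      · intro H hH
        obtain ⟨hH, heq⟩ := Finset.mem_filter.mp hH
        have hHP := Finset.mem_of_mem_erase hH
        have hHA := hPA hHP
        obtain ⟨c, hc⟩ := exists_eq_smul_of_ker_le_ker (K := K)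
          (α := form H₁ ∘ₗ (LinearMap.ker α).subtype) (β := form H ∘ₗ (LinearMap.ker α).subtype)
          (by rw [hcomap H hHA, hcomap H₁ hH₁A, heq])
        obtain ⟨d, hd⟩ := exists_eq_smul_of_ker_le_ker (K := K) (α := α)
          (β := form H - c • form H₁) fun x hx => by
            have := congr($hc ⟨x, hx⟩)
            simpa [sub_eq_zero] using this
        have hdec : form H = c • form H₁ + d • α := by rw [← hd]; abel
        refine linForm_dvd_derivation_sub hg (hθ H (mem_deletion_hyps.mpr
          ⟨Finset.ne_of_mem_erase hH, hHA⟩) _ (hform H hHA)) (c := c) (d := d) ?_ hdec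
        -- If `d = 0`, then `form H` is a multiple of `form H₁`, which forces `H = H₁`, although `H
        -- ∈ P` and `H₁ ∉ P`.
        rintro rfl
        refine not_le_of_mem_of_ne hH₁A hHA (fun h => hH₁P (h ▸ hHP)) ?_
        rw [← hform H hHA, ← hform H₁ hH₁A, hdec, hform H₁ hH₁A]
        intro x hx
        rw [← hform H₁ hH₁A, LinearMap.mem_ker] at hx
        simp [hx]
    have := map_dvd (resHom (LinearMap.ker α)) hdvd
    rwa [map_prod, map_sub, map_mul, resHom_ker_eq_zero, zero_mul, sub_zero] at this

/-- The addition theorem for a nice partition. -/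
theorem isFreeWithExponents_of_surjOn [FiniteDimensional K V] {A : HypArrangement K V}
    {α : Dual K V} (hα : α ≠ 0) {P : Finset (Submodule K V)} (hPA : P ⊆ A.hyps)
    (hP : LinearMap.ker α ∈ P) {n : ℕ} (hn : P.card = n + 1)
    (hsurj : ∀ Y ∈ (A.restriction (LinearMap.ker α)).hyps, ∃ H ∈ A.hyps, H ∉ P ∧
      H.comap (LinearMap.ker α).subtype = Y)
    {m : Multiset ℕ} (hres : (A.restriction (LinearMap.ker α)).IsFreeWithExponents m)
    (hdel : (A.deletion (LinearMap.ker α)).IsFreeWithExponents (n ::ₘ m)) :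
    A.IsFreeWithExponents ((n + 1) ::ₘ m) := by
  classical
  have hA := hPA hP
  have : ∀ H : Submodule K V, ∃ β : Dual K V, H ∈ A.hyps → LinearMap.ker β = H := fun H => by
    by_cases hH : H ∈ A.hyps
    · obtain ⟨β, -, hβ⟩ := exists_ker_eq_of_isCoatom (A.isCoatom H hH)
      exact ⟨β, fun _ => hβ⟩
    · exact ⟨0, fun h => absurd h hH⟩
  choose form hform using this
  have hcard : (P.erase (LinearMap.ker α)).card = n := by
    rw [Finset.card_erase_of_mem hP, hn, Nat.add_sub_cancel]
  refine isFreeWithExponents_of_deletion_of_restriction hα hA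
    (B := ∏ H ∈ P.erase (LinearMap.ker α), resHom (LinearMap.ker α) (linForm K V (form H)))
    ?_ (fun θ hθ => prod_resHom_dvd hA hPA hP ?_ hform hθ) hres hdel
  · simp only [resHom_linForm]
    rw [← hcard]
    exact prod_linForm_mem_homogComponent _ _
  · intro Y hY
    obtain ⟨H, hH, hHP, rfl⟩ := hsurj Y hY
    exact ⟨H, by simp [hH, hHP], rfl⟩

/-- The coordinates of a derivation of `S(V*)` with respect to a basis of `V*`. -/
noncomputable def derivationEquiv {ι : Type*} [Fintype ι] (b : Basis ι K (Dual K V)) :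
    Derivation K (CoordRing K V) (CoordRing K V) ≃ₗ[CoordRing K V] (ι → CoordRing K V) where
  toFun θ i := θ (linForm K V (b i))
  map_add' _ _ := rfl
  map_smul' _ _ := rfl
  invFun g := derivationOfLinearMap (b.constr K g)
  left_inv θ := derivation_ext fun α => by
    have : b.constr K (fun i => θ (linForm K V (b i))) = θ.toLinearMap ∘ₗ linForm K V :=
      b.ext fun i => by simp only [Basis.constr_basis]; rfl
    simpa using congr($this α)
  right_inv g := by
    ext i
    exact (derivationOfLinearMap_linForm _ _).trans (b.constr_basis K g i)

/-- Every derivation qualifies, and the partial derivatives, whose values on linear forms are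
constants, form a basis. -/
theorem isFreeWithExponents_empty (K : Type u) [Field K] (V : Type v) [AddCommGroup V] [Module K V]
    [FiniteDimensional K V] :
    (HypArrangement.empty K V).IsFreeWithExponents (Multiset.replicate (finrank K V) 0) := by
  have htop : (HypArrangement.empty K V).derivationModule = ⊤ :=
    eq_top_iff.mpr fun θ _ H hH => absurd hH (Finset.notMem_empty H)
  let b := (finBasis K V).dualBasis
  refine ⟨(Basis.ofEquivFun (derivationEquiv b)).map
    (Submodule.topEquiv.symm.trans (LinearEquiv.ofEq _ _ htop.symm)), fun _ => 0,
    fun i α => ?_, by simp⟩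
  have : ((((Basis.ofEquivFun (derivationEquiv b)).map (Submodule.topEquiv.symm.trans
      (LinearEquiv.ofEq _ _ htop.symm))) i : (HypArrangement.empty K V).derivationModule) :
      Derivation K (CoordRing K V) (CoordRing K V)) =
      derivationOfLinearMap (b.constr K (Pi.single i 1)) := by
    simp only [Basis.map_apply, Basis.coe_ofEquivFun]
    rfl
  rw [this, derivationOfLinearMap_linForm, Basis.constr_apply_fintype]
  refine Submodule.sum_mem _ fun j _ => Submodule.smul_mem _ _ ?_
  rw [homogComponent, pow_zero, Pi.single_apply]
  split_ifs
  · exact Submodule.one_le.mp le_rfl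
  · exact Submodule.zero_mem _

end Factorization

/-! ### Induction over factorizations -/

section InductiveFactorization

variable {K : Type u} [Field K]

open scoped Classical in
/-- An inductively factored arrangement is inductively free; its non-zero exponents are the
cardinalities of the blocks of an inductive factorization. -/
theorem IsInductiveFactorization.isInductivelyFree {V : Type v} [AddCommGroup V] [Module K V]
    [FiniteDimensional K V] {A : HypArrangement K V} {π : Finpartition A.hyps}
    (h : IsInductiveFactorization A π) :
    A.IsInductivelyFree ∧ π.parts.card ≤ finrank K V ∧
      A.IsFreeWithExponents (π.parts.val.map Finset.card +
        Multiset.replicate (finrank K V - π.parts.card) 0) := by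
  induction h with
  | @empty V _ _ _ π =>
    have hπ : π.parts = ∅ := Finpartition.parts_eq_empty_iff.mpr rfl
    refine ⟨.empty, by simp [hπ], ?_⟩
    simpa [hπ] using isFreeWithExponents_empty K V
  | @add V _ _ _ A π P₁ block H₀ mem bij π' parts_del del π'' parts_res res ih_del ih_res =>
    obtain ⟨free_del, card_del, exp_del⟩ := ih_del
    obtain ⟨free_res, card_res, exp_res⟩ := ih_res
    have hPA : P₁ ⊆ A.hyps := π.le block
    have hA := hPA mem
    obtain ⟨α, hα, rfl⟩ := exists_ker_eq_of_isCoatom (A.isCoatom _ hA)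
    obtain ⟨n, hn⟩ : ∃ n, P₁.card = n + 1 :=
      ⟨P₁.card - 1, (Nat.succ_pred_eq_of_pos (Finset.card_pos.mpr ⟨_, mem⟩)).symm⟩
    obtain ⟨p, hp⟩ : ∃ p, π.parts.card = p + 1 :=
      ⟨π.parts.card - 1, (Nat.succ_pred_eq_of_pos (Finset.card_pos.mpr ⟨_, block⟩)).symm⟩
    have hdim : finrank K (LinearMap.ker α) + 1 = finrank K V :=
      Module.Dual.finrank_ker_add_one_of_ne_zero hα
    have hsub : ∀ P ∈ π.parts.erase P₁, P ⊆ A.hyps \ P₁ := fun P hP =>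
      Finset.subset_sdiff.mpr ⟨π.le (Finset.mem_of_mem_erase hP),
        π.disjoint (Finset.mem_of_mem_erase hP) block (Finset.ne_of_mem_erase hP)⟩
    -- Injectivity of `ϱ` preserves the sizes of the blocks and keeps distinct blocks distinct;
    -- surjectivity is what the addition theorem uses.
    have hinj : ∀ P ∈ π.parts.erase P₁, Set.InjOn
        (fun H : Submodule K V => H.comap (LinearMap.ker α).subtype) P := fun P hP =>
      bij.injOn.mono (Finset.coe_subset.mpr (hsub P hP))
    have hinj' : Set.InjOn (fun P : Finset (Submodule K V) =>
        P.image fun H => H.comap (LinearMap.ker α).subtype) (π.parts.erase P₁) := by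
      intro P hP Q hQ hPQ
      have := congr(($hPQ : Set (Submodule K (LinearMap.ker α))))
      simp only [Finset.coe_image] at this
      exact Finset.coe_injective ((bij.injOn.image_eq_image_iff
        (Finset.coe_subset.mpr (hsub P hP)) (Finset.coe_subset.mpr (hsub Q hQ))).mp this)
    have hcard : (π.parts.erase P₁).card = p := by
      rw [Finset.card_erase_of_mem block, hp, Nat.add_sub_cancel]
    have hcard'' : π''.parts.card = p := by
      rw [parts_res, Finset.card_image_of_injOn hinj', hcard]
    have hexp : π.parts.val.map Finset.card =
        (n + 1) ::ₘ (π.parts.erase P₁).val.map Finset.card := by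
      rw [← hn, ← Multiset.map_cons, Finset.erase_val, Multiset.cons_erase block]
    have hexp'' : π''.parts.val.map Finset.card = (π.parts.erase P₁).val.map Finset.card := by
      rw [parts_res, Finset.image_val_of_injOn hinj', Multiset.map_map]
      exact Multiset.map_congr rfl fun P hP => Finset.card_image_of_injOn (hinj P hP)
    have hinter : ∀ P ∈ π.parts.erase P₁, P ∩ (A.deletion (LinearMap.ker α)).hyps = P :=
      fun P hP => Finset.inter_eq_left.mpr fun H hH => by
        obtain ⟨hHA, hHP⟩ := Finset.mem_sdiff.mp (hsub P hP hH)
        exact mem_deletion_hyps.mpr ⟨fun h => hHP (h ▸ mem), hHA⟩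
    have hinter₁ : P₁ ∩ (A.deletion (LinearMap.ker α)).hyps = P₁.erase (LinearMap.ker α) := by
      ext H
      rw [Finset.mem_inter, mem_deletion_hyps, Finset.mem_erase]
      exact ⟨fun h => ⟨h.2.1, h.1⟩, fun h => ⟨h.2, h.1, hPA h.2⟩⟩
    have hparts : π'.parts =
        (insert (P₁.erase (LinearMap.ker α)) (π.parts.erase P₁)).erase ∅ := by
      rw [parts_del]
      nth_rw 1 [← Finset.insert_erase block]
      rw [Finset.image_insert, hinter₁, Finset.image_congr (g := id) fun P hP => hinter P hP,
        Finset.image_id]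
    have hcard₁ : (P₁.erase (LinearMap.ker α)).card = n := by
      rw [Finset.card_erase_of_mem mem, hn, Nat.add_sub_cancel]
    have hempty : ∅ ∉ π.parts.erase P₁ := fun h =>
      π.bot_notMem (Finset.mem_of_mem_erase h)
    set m : Multiset ℕ := (π.parts.erase P₁).val.map Finset.card +
      Multiset.replicate (finrank K (LinearMap.ker α) - p) 0 with hm
    have exp_del' : (A.deletion (LinearMap.ker α)).IsFreeWithExponents (n ::ₘ m) := by
      convert exp_del using 1
      -- If `P₁ = {H₀}`, the block disappears from `π'`, and the exponent `n = 0` is supplied by one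
      -- more zero of the padding; the bound `p ≤ dim H₀` keeps the truncated subtraction exact.
      -- Otherwise `P₁ \ {H₀}` is a block of size `n`.
      by_cases h0 : P₁.erase (LinearMap.ker α) = ∅
      · rw [h0, Finset.erase_insert hempty] at hparts
        rw [h0, Finset.card_empty] at hcard₁
        rw [hparts, hcard, ← hcard₁, hm, ← Multiset.add_cons, ← Multiset.replicate_succ, ← hdim,
          Nat.sub_add_comm (hcard'' ▸ card_res)]
      · have hnot : P₁.erase (LinearMap.ker α) ∉ π.parts.erase P₁ := fun hmem => by
          obtain ⟨H, hH⟩ := Finset.nonempty_iff_ne_empty.mpr h0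
          exact (Finset.mem_sdiff.mp (hsub _ hmem hH)).2 (Finset.mem_of_mem_erase hH)
        rw [Finset.erase_eq_of_notMem (by
          rw [Finset.mem_insert, not_or]; exact ⟨fun h => h0 h.symm, hempty⟩)] at hparts
        rw [hparts, Finset.card_insert_of_notMem hnot, hcard, Finset.insert_val_of_notMem hnot,
          Multiset.map_cons, hcard₁, Multiset.cons_add, ← hdim, Nat.add_sub_add_right]
    have exp_res' : (A.restriction (LinearMap.ker α)).IsFreeWithExponents m := by
      rwa [hexp'', hcard''] at exp_res
    refine ⟨.add A _ hA free_del free_res _ _ exp_del' exp_res' (Multiset.le_cons_self _ _), ?_, ?_⟩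
    · rw [hp, ← hdim]
      exact Nat.succ_le_succ (hcard'' ▸ card_res)
    · rw [hexp, hp, ← hdim, Nat.add_sub_add_right, Multiset.cons_add]
      refine isFreeWithExponents_of_surjOn hα hPA mem hn (fun Y hY => ?_) exp_res' exp_del'
      obtain ⟨H, hH, rfl⟩ := bij.surjOn hY
      obtain ⟨hHA, hHP⟩ := Finset.mem_sdiff.mp (Finset.mem_coe.mp hH)
      exact ⟨H, hHA, hHP, rfl⟩

end InductiveFactorization

end HypArrangement

theorem mainTheorem10 {K : Type u} [Field K] {V : Type v} [AddCommGroup V] [Module K V]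
    [FiniteDimensional K V] (A : HypArrangement K V)
    (hA : A.IsHereditarilyInductivelyFactored) :
    A.IsHereditarilyInductivelyFree := by
  intro X hX
  obtain ⟨π, hπ⟩ := hA X hX
  exact hπ.isInductivelyFree.1
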